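/- Consider $n\ge 1$ nodes that share a channel to a base station. In each handshake of duration $T_0>0$, node $i$ sends, independently of the others, an RTS packet of duration $\tilde T_0\in(0,T_0)$ with probability $p_i\in[0,1]$ (let $B_i\in\{0,1\}$ be the indicator), all transmissions having power $P_T>0$. The squared channel gains $|h_i|^2$ are independent exponential variables with mean one, independent of the $B_i$. Node $i$ is granted the channel if $$\mathrm{SINR}_i=\frac{B_i|h_i|^2P_T}{N_0+\sum_{j\ne i}B_j|h_j|^2P_T}>b,$$ where $N_0>0$ is the noise power and $b>1$ the capture ratio (so at most one node is granted the channel); it then sends data, one packet per slot, for a period $T_i>0$, with average frame success rate $P^s_i(T_i)\in(0,1]$. Let $G_i$ be the probability that node $i$ is granted the channel in a handshake. The average throughput and the (normalized) average power consumption of node $i$ are $$r_i(\mathbf p)=\frac{P^s_i(T_i)\,G_iT_i}{T_0+\sum_jG_jT_j},\qquad S_i(\mathbf p)=\frac{p_i\tilde T_0+G_iT_i}{T_0+\sum_jG_jT_j}.$$ For demands $\rho_1,\dots,\rho_n\ge 0$, a vector $\mathbf p\in[0,1]^n$ is a Nash equilibrium if, for every $i$, $p_i$ minimizes $S_i(\tilde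 p_i,\mathbf p_{-i})$ over all $\tilde p_i\in[0,1]$ with $r_i(\tilde p_i,\mathbf p_{-i})\ge\rho_i$ (and $p_i$ itself satisfies this constraint); it is the better Nash equilibrium if moreover $\sum_ip_i\le\frac{b+1}{b}$. The demands are feasible, $(\rho_1,\dots,\rho_n)\in\Omega(T_1,\dots,T_n)$, if a Nash equilibrium exists for them. Put $\beta=\tilde T_0/T_0$, $\overline m'=\max_i\frac{T_i}{T_0}\,e^{-bN_0/P_T}$, $\underline m'=\min_i\frac{T_i}{T_0}\,e^{-bN_0/P_T}$, $\Gamma(n)=\frac{b+1}{b}\left(1-\frac1n\right)^{n-1}$ and, for $n\ge2$, $$\Psi_{b,n}=\frac{(n-1)(1+b)^2-nb}{b(1+b)(n-1)}\left[\frac{bn+n-b-2}{(1+b)(n-1)}\right]^{n-2},\qquad \theta=\frac{\overline m'b(1-\Psi_{b,n})}{1+\overline m'+\overline m'b(1-\Psi_{b,n})}.$$ **Corollary.** Let $b>2$. For all feasible demands $(\rho_1,\dots,\rho_n)\in\Omega(T_1,\dots,T_n)$, the total average power consumption at the better Nash equilibrium $\mathbf p$ satisfies: 1. if $n=1$, then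 $S_1(p_1)\le\frac{\overline m'+\beta}{\overline m'+1}$; 2. if $n>1$, then $$\sum_iS_i(\mathbf p)\le\begin{cases}\dfrac{\overline m'+\beta}{\overline m'+1}&\text{if }\beta\le\theta,\\[2ex]\dfrac{\overline m'\Psi_{b,n}+\beta\frac{b+1}{b}}{\overline m'\Psi_{b,n}+1}&\text{if }\theta\le\beta\le\frac{b}{b+1},\\[2ex]\dfrac{\underline m'\Gamma(n)+\beta\frac{b+1}{b}}{\underline m'\Gamma(n)+1}&\text{if }\beta\ge\frac{b}{b+1}.\end{cases}$$ In particular, in all cases, $\sum_iS_i(\mathbf p)\le\max\left\{1,\beta\frac{b+1}{b}\right\}$. -/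

import Mathlib

open MeasureTheory ProbabilityTheory

noncomputable section

namespace CSMA

/-- The parameters of a CSMA network of `n` nodes with an RTS/CTS handshake over a Rayleigh
fading channel with SINR capture. -/
structure Network (n : ℕ) where
  /-- capture ratio -/
  b : ℝ
  /-- power of the additive noise at the base station -/
  N₀ : ℝ
  /-- transmission power, common to all nodes -/
  PT : ℝ
  /-- duration of one RTS/CTS handshake -/
  T₀ : ℝ
  /-- duration of an RTS packet -/
  TRTS : ℝ
  /-- `Ps i t` is the average frame success rate of node `i` for data period `t` -/
  Ps : Fin n → ℝ → ℝ
  one_lt_b : 1 < b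
  N₀_pos : 0 < N₀
  PT_pos : 0 < PT
  T₀_pos : 0 < T₀
  TRTS_pos : 0 < TRTS
  TRTS_lt : TRTS < T₀
  Ps_mem : ∀ i t, 0 < t → Ps i t ∈ Set.Ioc (0 : ℝ) 1

/-- A request vector: node `i` sends an RTS packet with probability `p i ∈ [0, 1]`. -/
abbrev Request (n : ℕ) := Fin n → unitInterval

/-- An outcome of one handshake: the request indicators `B i ∈ {0, 1}` and the squared moduli
`|h i| ^ 2` of the channel gains. -/
abbrev Outcome (n : ℕ) := (Fin n → ℝ) × (Fin n → ℝ)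

/-- The law of one handshake under the request vector `p`: the requests are independent
Bernoulli variables, the squared channel gains are independent exponential variables of mean
one, and the two families are independent of each other. -/
def law {n : ℕ} (p : Request n) : Measure (Outcome n) :=
  (Measure.pi fun i => bernoulliMeasure (1 : ℝ) 0 (p i)).prod
    (Measure.pi fun _ => expMeasure 1)

namespace Network

variable {n : ℕ} (N : Network n)

/-- The SINR of the RTS packet of node `i`. -/
def sinr (i : Fin n) (ω : Outcome n) : ℝ :=
  ω.1 i * ω.2 i * N.PT / (N.N₀ + ∑ j ∈ Finset.univ.erase i, ω.1 j * ω.2 j * N.PT)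

/-- The event that the base station grants data transmission to node `i`. -/
def granted (i : Fin n) : Set (Outcome n) := {ω | N.b < N.sinr i ω}

/-- The duration of one cycle: a handshake, followed by the data period `T j` of the node `j`
that was granted the channel, if there is one. -/
def cycleLength (T : Fin n → ℝ) (ω : Outcome n) : ℝ :=
  N.T₀ + ∑ j, (N.granted j).indicator (fun _ => T j) ω

/-- The time in one cycle during which node `i` transmits its RTS packet or data. -/
def airtime (T : Fin n → ℝ) (i : Fin n) (ω : Outcome n) : ℝ :=
  ω.1 i * N.TRTS + (N.granted i).indicator (fun _ => T i) ω

/-- The number of data packets of node `i` successfully received in one cycle, averaged over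
the frame errors (one data packet is sent per slot). -/
def delivered (T : Fin n → ℝ) (i : Fin n) (ω : Outcome n) : ℝ :=
  (N.granted i).indicator (fun _ => N.Ps i (T i) * T i) ω

/-- The average throughput `r i` of node `i`: the expected number of data packets delivered in
a cycle per expected duration of a cycle. -/
def throughput (T : Fin n → ℝ) (i : Fin n) (p : Request n) : ℝ :=
  (∫ ω, N.delivered T i ω ∂law p) / ∫ ω, N.cycleLength T ω ∂law p

/-- The average power consumption `S i` of node `i`, in units of the transmission power: the
fraction of time in which it transmits RTS or data packets. -/
def power (T : Fin n → ℝ) (i : Fin n) (p : Request n) : ℝ :=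
  (∫ ω, N.airtime T i ω ∂law p) / ∫ ω, N.cycleLength T ω ∂law p

/-- The utility of node `i`. -/
def utility (T : Fin n → ℝ) (i : Fin n) (p : Request n) : ℝ := 1 - N.power T i p

/-- `p` is a constrained Nash equilibrium for the throughput demands `ρ`: every node meets its
demand, and has the largest utility among its own choices that meet the demand. -/
def IsNash (T : Fin n → ℝ) (ρ : Fin n → ℝ) (p : Request n) : Prop :=
  ∀ i, ρ i ≤ N.throughput T i p ∧
    ∀ q : unitInterval, ρ i ≤ N.throughput T i (Function.update p i q) →
      N.utility T i (Function.update p i q) ≤ N.utility T i p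

/-- The feasible throughput region `Ω(T 1, …, T n)`. -/
def feasibleRegion (T : Fin n → ℝ) : Set (Fin n → ℝ) :=
  {ρ | (∀ i, 0 ≤ ρ i) ∧ ∃ p, N.IsNash T ρ p}

/-- `p` is a better Nash equilibrium for the throughput demands `ρ`. -/
def IsBetterNash (T : Fin n → ℝ) (ρ : Fin n → ℝ) (p : Request n) : Prop :=
  N.IsNash T ρ p ∧ ∑ i, (p i : ℝ) ≤ (N.b + 1) / N.b

/-- The RTS fraction `β`. -/
def β : ℝ := N.TRTS / N.T₀

/-- `max_i (T i / T₀) * exp (-b N₀ / PT)` -/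
def mUpper (T : Fin n → ℝ) : ℝ := (⨆ i, T i / N.T₀) * Real.exp (-(N.b * (N.N₀ / N.PT)))

/-- `min_i (T i / T₀) * exp (-b N₀ / PT)` -/
def mLower (T : Fin n → ℝ) : ℝ := (⨅ i, T i / N.T₀) * Real.exp (-(N.b * (N.N₀ / N.PT)))

end Network

/-- `Γ(n)`, for `n ≥ 1` -/
def Gam (b : ℝ) (n : ℕ) : ℝ := (b + 1) / b * (1 - 1 / (n : ℝ)) ^ (n - 1)

/-- `Ψ_{b,n}`, for `n ≥ 2` -/
def Psi (b : ℝ) (n : ℕ) : ℝ :=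
  (((n : ℝ) - 1) * (1 + b) ^ 2 - n * b) / (b * (1 + b) * ((n : ℝ) - 1)) *
    ((b * n + n - b - 2) / ((1 + b) * ((n : ℝ) - 1))) ^ (n - 2)

/-- The value of the RTS fraction that separates the first two cases of the bound. -/
def threshold (b : ℝ) (n : ℕ) (m : ℝ) : ℝ :=
  m * b * (1 - Psi b n) / (1 + m + m * b * (1 - Psi b n))

end CSMA

end

/-! ### Rayleigh fading: grant probabilities and the formula for the total power. -/

namespace CSMA

/-! Put c = b/(b+1) and s = ∑ p_i. Integrating out the fading and the requests gives G_i =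
exp(-bN₀/P_T) p_i ∏_{j≠i}(1 - c p_j), so the total power is (βs + x)/(1 + x): the mean of βs and 1
with weights 1 and x, where x is a weighted sum of the g_i = p_i ∏_{j≠i}(1 - c p_j). It increases in
x when βs ≤ 1 and decreases when βs ≥ 1. Everything thus reduces to bounding g = ∑ g_i in terms of s
≤ 1/c. With q = c p, the number c g is the probability that exactly one of n independent events with
probabilities q_i occurs.

Upper bounds: g ≤ s always, which settles s ≤ 1. For 1 ≤ s ≤ 1/c, moving mass between two
coordinates shows that c g is largest when one q_i equals c and the others are equal; b > 2, that is
c > 2/3, makes equalizing the others profitable. The resulting maximum is convex in s, so it lies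
below its chord, which gives g ≤ 1 - (1 - Ψ) b(s - 1) (`grantSum_le_of_one_le_sum`). The power bound
is then a quotient of affine functions of s, controlled by its values at s = 1 and s = 1/c. These
are the first two bounds, and θ is the β at which they agree.

Lower bound, for β ≥ c: two applications of Jensen's inequality give g ≥ s (1 - 1/n)^{n-1}
(`mul_Gam_le_grantSum`). -/

instance : IsProbabilityMeasure (expMeasure 1) := isProbabilityMeasure_expMeasure one_pos

lemma measureReal_expMeasure_Ioi {x : ℝ} (hx : 0 ≤ x) :
    (expMeasure 1).real (Set.Ioi x) = Real.exp (-x) := by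
  have h := cdf_expMeasure_eq one_pos x
  rw [cdf_eq_real, if_pos hx] at h
  have h2 := probReal_compl_eq_one_sub (μ := expMeasure 1) (measurableSet_Iic (a := x))
  rw [Set.compl_Iic, h] at h2
  rw [h2]; simp

lemma ae_expMeasure_nonneg : ∀ᵐ x ∂expMeasure 1, 0 ≤ x := by
  have h := cdf_expMeasure_eq one_pos 0
  rw [cdf_eq_real] at h
  have h0 : expMeasure 1 (Set.Iic 0) = 0 := by
    rw [← measureReal_eq_zero_iff]; simpa using h
  rw [ae_iff]
  exact measure_mono_null (fun x (hx : ¬ 0 ≤ x) => (not_le.1 hx).le) h0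

lemma integral_exp_neg_mul_expMeasure {a : ℝ} (ha : 0 ≤ a) :
    ∫ x, Real.exp (-(a * x)) ∂expMeasure 1 = 1 / (1 + a) := by
  have hm : Measurable (gammaPDF 1 1) := (measurable_gammaPDFReal 1 1).ennreal_ofReal
  rw [expMeasure, gammaMeasure, integral_withDensity_eq_integral_toReal_smul hm
    (ae_of_all _ fun x => by simp [gammaPDF])]
  have : ∀ x, (gammaPDF 1 1 x).toReal • Real.exp (-(a * x)) =
      (Set.Ici (0 : ℝ)).indicator (fun x => Real.exp (-(1 + a) * x)) x := by
    intro x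
    have := exponentialPDF_eq 1 x
    rw [exponentialPDF, exponentialPDFReal] at this
    rw [gammaPDF, this]
    by_cases hx : 0 ≤ x
    · rw [if_pos hx, Set.indicator_of_mem (Set.mem_Ici.2 hx), ENNReal.toReal_ofReal (by positivity),
        smul_eq_mul, one_mul, ← Real.exp_add]
      congr 1; ring
    · rw [if_neg hx, Set.indicator_of_notMem (by simpa using hx)]; simp
  simp_rw [this]
  rw [integral_indicator measurableSet_Ici, integral_Ici_eq_integral_Ioi,
    integral_exp_mul_Ioi (by linarith)]
  rw [mul_zero, Real.exp_zero, neg_div_neg_eq]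

lemma ae_pi_forall {ι : Type*} [Fintype ι] {μ : ι → Measure ℝ} [∀ i, IsProbabilityMeasure (μ i)]
    {P : ι → ℝ → Prop} (h : ∀ i, ∀ᵐ x ∂μ i, P i x) :
    ∀ᵐ x ∂Measure.pi μ, ∀ i, P i (x i) :=
  ae_all_iff.2 fun i => (Measure.tendsto_eval_ae_ae (μ := μ) (i := i)).eventually (h i)

lemma sum_erase_eq_sum_succAbove {m : ℕ} (i : Fin (m + 1)) (f : Fin (m + 1) → ℝ) :
    ∑ j ∈ Finset.univ.erase i, f j = ∑ k, f (i.succAbove k) := by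
  rw [Finset.sum_erase_eq_sub (Finset.mem_univ i), Fin.sum_univ_succAbove f i]; ring

lemma prod_erase_eq_prod_succAbove {m : ℕ} (i : Fin (m + 1)) (f : Fin (m + 1) → ℝ) :
    ∏ j ∈ Finset.univ.erase i, f j = ∏ k, f (i.succAbove k) := by
  have : Finset.univ.erase i = Finset.univ.image i.succAbove := by
    rw [Fin.image_succAbove_univ]; ext; simp
  rw [this, Finset.prod_image fun _ _ _ _ h => Fin.succAbove_right_injective h]

namespace Network

variable {n : ℕ} (N : Network n)

lemma measurable_sinr (i : Fin n) : Measurable (N.sinr i) := by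
  unfold sinr; fun_prop

lemma measurableSet_granted (i : Fin n) : MeasurableSet (N.granted i) :=
  measurableSet_lt measurable_const (N.measurable_sinr i)

/-- Rayleigh fading turns interference into a product: the probability that a transmission
survives, given who transmits. -/
lemma integral_granted_fading {m : ℕ} (N : Network (m + 1)) (i : Fin (m + 1))
    {B : Fin (m + 1) → ℝ} (hB : ∀ j, B j = 0 ∨ B j = 1) :
    ∫ h, (N.granted i).indicator (fun _ => (1 : ℝ)) (B, h) ∂(Measure.pi fun _ => expMeasure 1) =
      Real.exp (-(N.b * (N.N₀ / N.PT))) *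
        (B i * ∏ j ∈ Finset.univ.erase i, 1 / (1 + N.b * B j)) := by
  have hb := N.one_lt_b
  have hN := N.N₀_pos
  have hP := N.PT_pos
  have hB0 : ∀ j, 0 ≤ B j := fun j => by rcases hB j with h | h <;> simp [h]
  rcases hB i with hi | hi
  · have : ∀ h : Fin (m + 1) → ℝ, (N.granted i).indicator (fun _ => (1 : ℝ)) (B, h) = 0 := by
      intro h
      apply Set.indicator_of_notMem
      simp only [granted, sinr, Set.mem_ofPred_eq, hi]
      simp; linarith
    simp [this, hi]
  · rw [prod_erase_eq_prod_succAbove]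
    have e := (measurePreserving_piFinSuccAbove (fun _ : Fin (m + 1) => expMeasure 1) i).symm
    rw [← e.integral_comp']
    have hmeas : Measurable fun z : ℝ × (Fin m → ℝ) =>
        (N.granted i).indicator (fun _ => (1 : ℝ))
          (B, (MeasurableEquiv.piFinSuccAbove (fun _ => ℝ) i).symm z) :=
      (measurable_const.indicator (N.measurableSet_granted i)).comp
        (measurable_const.prodMk (MeasurableEquiv.measurable _))
    rw [integral_prod_symm _ (Integrable.of_bound hmeas.aestronglyMeasurable 1
      (ae_of_all _ fun z => by
        exact (norm_indicator_le_norm_self _ _).trans (by simp)))]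
    -- With the interfering gains y fixed, a grant means that the gain of node i exceeds a threshold
    -- affine in y. The exponential tail at that threshold factors over the interferers, leaving one
    -- Laplace transform per interferer.
    have key : ∀ᵐ y ∂(Measure.pi fun _ : Fin m => expMeasure 1),
        ∫ x, (N.granted i).indicator (fun _ => (1 : ℝ))
          (B, (MeasurableEquiv.piFinSuccAbove (fun _ => ℝ) i).symm (x, y)) ∂expMeasure 1 =
        Real.exp (-(N.b * (N.N₀ / N.PT))) *
          ∏ k, Real.exp (-((N.b * B (i.succAbove k)) * y k)) := by
      filter_upwards [ae_pi_forall (fun _ : Fin m => ae_expMeasure_nonneg)] with y hy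
      have hS : 0 ≤ ∑ k, B (i.succAbove k) * y k :=
        Finset.sum_nonneg fun k _ => mul_nonneg (hB0 _) (hy k)
      have hset : ∀ x, (N.granted i).indicator (fun _ => (1 : ℝ))
          (B, (MeasurableEquiv.piFinSuccAbove (fun _ => ℝ) i).symm (x, y)) =
          (Set.Ioi (N.b * (N.N₀ / N.PT) + N.b * ∑ k, B (i.succAbove k) * y k)).indicator
            (fun _ => (1 : ℝ)) x := by
        intro x
        have : (B, (MeasurableEquiv.piFinSuccAbove (fun _ => ℝ) i).symm (x, y)) ∈ N.granted i ↔
            x ∈ Set.Ioi (N.b * (N.N₀ / N.PT) + N.b * ∑ k, B (i.succAbove k) * y k) := by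
          simp only [granted, sinr, Set.mem_ofPred_eq, sum_erase_eq_sum_succAbove, hi,
            MeasurableEquiv.piFinSuccAbove_symm_apply, Fin.insertNthEquiv_apply,
            Fin.insertNth_apply_same, Fin.insertNth_apply_succAbove, Set.mem_Ioi]
          rw [← Finset.sum_mul, lt_div_iff₀ (by positivity), ← mul_lt_mul_iff_left₀ hP (c := x)]
          have : (N.b * (N.N₀ / N.PT) + N.b * ∑ k, B (i.succAbove k) * y k) * N.PT =
            N.b * (N.N₀ + (∑ k, B (i.succAbove k) * y k) * N.PT) := by field_simp
          rw [this, one_mul]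
        by_cases h : x ∈ Set.Ioi (N.b * (N.N₀ / N.PT) + N.b * ∑ k, B (i.succAbove k) * y k)
        · rw [Set.indicator_of_mem h, Set.indicator_of_mem (this.2 h)]
        · rw [Set.indicator_of_notMem h, Set.indicator_of_notMem (mt this.1 h)]
      simp_rw [hset]
      rw [integral_indicator_const _ measurableSet_Ioi,
        measureReal_expMeasure_Ioi (by positivity), smul_eq_mul, mul_one, ← Real.exp_sum,
        ← Real.exp_add]
      congr 1
      rw [Finset.sum_neg_distrib, Finset.mul_sum, neg_add]
      simp_rw [mul_assoc]
    rw [integral_congr_ae key, integral_const_mul, hi, one_mul,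
      integral_fintype_prod_eq_prod fun k x => Real.exp (-((N.b * B (i.succAbove k)) * x))]
    congr 1
    refine Finset.prod_congr rfl fun k _ => integral_exp_neg_mul_expMeasure ?_
    have := hB0 (i.succAbove k)
    positivity

instance (p : Request n) : IsProbabilityMeasure (law p) := by unfold law; infer_instance

lemma integrable_indicator_granted (p : Request n) (i : Fin n) (c : ℝ) :
    Integrable ((N.granted i).indicator fun _ => c) (law p) :=
  (integrable_const c).indicator (N.measurableSet_granted i)

lemma ae_bernoulliMeasure (q : unitInterval) :
    ∀ᵐ x ∂bernoulliMeasure (1 : ℝ) 0 q, x = 0 ∨ x = 1 := by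
  have : {x : ℝ | ¬(x = 0 ∨ x = 1)} = {0, 1}ᶜ := by ext; simp
  rw [ae_iff, this, bernoulliMeasure_apply_of_notMem_of_notMem _
    (Set.toFinite _).measurableSet.compl] <;> simp

/-- The probability that node `i` is granted the channel. -/
lemma measureReal_granted (p : Request n) (i : Fin n) :
    (law p).real (N.granted i) = Real.exp (-(N.b * (N.N₀ / N.PT))) *
      ((p i : ℝ) * ∏ j ∈ Finset.univ.erase i, (1 - N.b / (N.b + 1) * p j)) := by
  obtain _ | m := n
  · exact i.elim0
  have hb := N.one_lt_b
  rw [← mul_one ((law p).real _), ← smul_eq_mul,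
    ← integral_indicator_const (1 : ℝ) (N.measurableSet_granted i), law, integral_prod]
  swap
  · exact N.integrable_indicator_granted p i 1
  -- The conditional probability is written as a product of functions of single coordinates, so that
  -- independence turns its mean into a product of means.
  have h1 : ∀ᵐ B ∂(Measure.pi fun j => bernoulliMeasure (1 : ℝ) 0 (p j)),
      ∫ h, (N.granted i).indicator (fun _ => (1 : ℝ)) (B, h) ∂(Measure.pi fun _ => expMeasure 1) =
      Real.exp (-(N.b * (N.N₀ / N.PT))) *
        ∏ j, (fun j x => if j = i then x else 1 / (1 + N.b * x)) j (B j) := by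
    filter_upwards [ae_pi_forall fun j => ae_bernoulliMeasure (p j)] with B hB
    rw [← Finset.mul_prod_erase _ _ (Finset.mem_univ i)]
    refine (N.integral_granted_fading i hB).trans ?_
    simp only [if_true]
    congr 2
    exact Finset.prod_congr rfl fun j hj => by rw [if_neg (Finset.ne_of_mem_erase hj)]
  rw [integral_congr_ae h1, integral_const_mul,
    integral_fintype_prod_eq_prod fun j x => if j = i then x else 1 / (1 + N.b * x),
    ← Finset.mul_prod_erase _ _ (Finset.mem_univ i)]
  congr 2
  · simp [integral_bernoulliMeasure]
  -- For j ≠ i the mean of 1/(1 + b B_j) is (1 - p_j) + p_j/(1 + b) = 1 - (b/(b+1)) p_j.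
  · refine Finset.prod_congr rfl fun j hj => ?_
    simp only [if_neg (Finset.ne_of_mem_erase hj), integral_bernoulliMeasure, smul_eq_mul]
    field_simp
    ring

lemma integral_cycleLength (T : Fin n → ℝ) (p : Request n) :
    ∫ ω, N.cycleLength T ω ∂law p = N.T₀ + ∑ j, (law p).real (N.granted j) * T j := by
  unfold cycleLength
  rw [integral_add (integrable_const _)
    (integrable_finsetSum _ fun j _ => N.integrable_indicator_granted p j _),
    integral_finsetSum _ fun j _ => N.integrable_indicator_granted p j _]
  simp [integral_indicator_const, N.measurableSet_granted]

lemma integral_request (p : Request n) (i : Fin n) : ∫ ω, ω.1 i ∂law p = p i := by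
  rw [law, integral_fun_fst (fun B : Fin n → ℝ => B i)]
  have := (measurePreserving_eval (fun j => bernoulliMeasure (1 : ℝ) 0 (p j)) i)
  have h2 := integral_map (μ := Measure.pi fun j => bernoulliMeasure (1 : ℝ) 0 (p j))
    this.measurable.aemeasurable (f := fun x : ℝ => x) (by fun_prop)
  rw [this.map_eq] at h2
  simp only [Function.eval] at h2
  rw [← h2]
  simp [integral_bernoulliMeasure]

lemma integrable_request (p : Request n) (i : Fin n) :
    Integrable (fun ω : Outcome n => ω.1 i) (law p) := by
  refine Integrable.of_bound (by fun_prop) 1 ?_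
  have h := ae_pi_forall fun j => ae_bernoulliMeasure (p j)
  have h2 := (Measure.quasiMeasurePreserving_fst
    (μ := Measure.pi fun i => bernoulliMeasure (1 : ℝ) 0 (p i))
    (ν := Measure.pi fun _ : Fin n => expMeasure 1)).ae h
  filter_upwards [h2] with ω hω
  rcases hω i with h | h <;> simp [h]

lemma integral_airtime (T : Fin n → ℝ) (i : Fin n) (p : Request n) :
    ∫ ω, N.airtime T i ω ∂law p = p i * N.TRTS + (law p).real (N.granted i) * T i := by
  unfold airtime
  rw [integral_add ((integrable_request p i).mul_const _) (N.integrable_indicator_granted p i _),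
    integral_mul_const, integral_request]
  simp [integral_indicator_const, N.measurableSet_granted]

/-- All nodes share the denominator, the mean cycle length; dividing by T₀ exhibits the form (βs +
x)/(1 + x). -/
lemma sum_power_eq (T : Fin n → ℝ) (p : Request n) :
    ∑ i, N.power T i p =
      (N.β * ∑ i, (p i : ℝ) + ∑ i, T i / N.T₀ * Real.exp (-(N.b * (N.N₀ / N.PT))) *
        ((p i : ℝ) * ∏ j ∈ Finset.univ.erase i, (1 - N.b / (N.b + 1) * p j))) /
      (1 + ∑ i, T i / N.T₀ * Real.exp (-(N.b * (N.N₀ / N.PT))) *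
        ((p i : ℝ) * ∏ j ∈ Finset.univ.erase i, (1 - N.b / (N.b + 1) * p j))) := by
  have hT := N.T₀_pos
  unfold power
  rw [← Finset.sum_div, integral_cycleLength]
  simp_rw [integral_airtime]
  have hx : ∑ i, T i / N.T₀ * Real.exp (-(N.b * (N.N₀ / N.PT))) *
        ((p i : ℝ) * ∏ j ∈ Finset.univ.erase i, (1 - N.b / (N.b + 1) * p j)) =
      (∑ i, (law p).real (N.granted i) * T i) / N.T₀ := by
    rw [Finset.sum_div]
    exact Finset.sum_congr rfl fun i _ => by rw [measureReal_granted]; ring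
  rw [hx, Finset.sum_add_distrib, ← Finset.sum_mul, ← mul_div_mul_left _ (1 + _) hT.ne', β]
  congr 1 <;> field_simp

end Network

end CSMA

/-! ### Extremal values of the probability that exactly one event occurs. -/

namespace CSMA

/-- The vectors with coordinates in `[0, c]` and coordinate sum `l`. -/
def cappedSimplex (ι : Type*) [Fintype ι] (c l : ℝ) : Set (ι → ℝ) :=
  {q | (∀ i, 0 ≤ q i ∧ q i ≤ c) ∧ ∑ i, q i = l}

lemma isCompact_cappedSimplex {ι : Type*} [Fintype ι] (c l : ℝ) : IsCompact (cappedSimplex ι c l) := by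
  have : cappedSimplex ι c l =
      Set.Icc (fun _ : ι => (0 : ℝ)) (fun _ => c) ∩ {q | ∑ i, q i = l} := by
    ext q; simp [cappedSimplex, Set.mem_Icc, Pi.le_def, forall_and]
  rw [this]
  exact isCompact_Icc.inter_right (isClosed_eq (by fun_prop) continuous_const)

section ExactlyOne

variable {ι : Type*} [DecidableEq ι]

/-- The probability that exactly one of the independent events indexed by `s` occurs, when event
`i` has probability `q i`. -/
def exactlyOne (s : Finset ι) (q : ι → ℝ) : ℝ :=
  ∑ i ∈ s, q i * ∏ j ∈ s.erase i, (1 - q j)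

lemma exactlyOne_insert {s : Finset ι} {a : ι} (ha : a ∉ s) (q : ι → ℝ) :
    exactlyOne (insert a s) q =
      q a * ∏ j ∈ s, (1 - q j) + (1 - q a) * exactlyOne s q := by
  unfold exactlyOne
  rw [Finset.sum_insert ha, Finset.erase_insert ha, Finset.mul_sum]
  congr 1
  refine Finset.sum_congr rfl fun i hi => ?_
  have hai : a ≠ i := fun h => ha (h ▸ hi)
  rw [Finset.erase_insert_of_ne hai, Finset.prod_insert fun h => ha (Finset.mem_of_mem_erase h)]
  ring

lemma exactlyOne_congr {s : Finset ι} {q q' : ι → ℝ} (h : ∀ k ∈ s, q' k = q k) :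
    exactlyOne s q' = exactlyOne s q :=
  Finset.sum_congr rfl fun i hi => by
    rw [h i hi, Finset.prod_congr rfl fun j hj => by rw [h j (Finset.mem_of_mem_erase hj)]]

lemma exactlyOne_const (s : Finset ι) {q : ι → ℝ} {y : ℝ} (h : ∀ k ∈ s, q k = y) :
    exactlyOne s q = s.card * y * (1 - y) ^ (s.card - 1) := by
  rw [exactlyOne_congr (q := fun _ => y) h, exactlyOne, Finset.sum_congr rfl
    (g := fun _ => y * (1 - y) ^ (s.card - 1)) fun i hi => by
      rw [Finset.prod_const, Finset.card_erase_of_mem hi]]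
  simp; ring

lemma exactlyOne_le_sum {s : Finset ι} {q : ι → ℝ} (h0 : ∀ i, 0 ≤ q i) (h1 : ∀ i, q i ≤ 1) :
    exactlyOne s q ≤ ∑ i ∈ s, q i :=
  Finset.sum_le_sum fun i _ => mul_le_of_le_one_right (h0 i) <|
    Finset.prod_le_one (fun j _ => by linarith [h1 j]) fun j _ => by linarith [h0 j]

lemma exactlyOne_nonneg {s : Finset ι} {q : ι → ℝ} (h0 : ∀ i, 0 ≤ q i) (h1 : ∀ i, q i ≤ 1) :
    0 ≤ exactlyOne s q :=
  Finset.sum_nonneg fun i _ => mul_nonneg (h0 i) <|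
    Finset.prod_nonneg fun j _ => by linarith [h1 j]

lemma exactlyOne_continuous (s : Finset ι) : Continuous fun q : ι → ℝ => exactlyOne s q := by
  unfold exactlyOne; fun_prop

/-- With A = ∏_s (1 - q_k) and B = `exactlyOne s q`, the full value is (q_i + q_j - 2 q_i q_j) A +
(1 - q_i)(1 - q_j) B. At fixed q_i + q_j it is affine in q_i q_j with slope B - 2A, so the sign of B
- 2A decides whether to equalize or to spread the pair. -/
lemma exactlyOne_transfer {s : Finset ι} {i j : ι} (hi : i ∉ s) (hj : j ∉ s) (hij : i ≠ j)
    {q q' : ι → ℝ} (h : ∀ k ∈ s, q' k = q k) (hsum : q' i + q' j = q i + q j) :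
    exactlyOne (insert i (insert j s)) q' - exactlyOne (insert i (insert j s)) q =
      (exactlyOne s q - 2 * ∏ k ∈ s, (1 - q k)) * (q' i * q' j - q i * q j) := by
  have hi' : i ∉ insert j s := by simp [hi, hij]
  rw [exactlyOne_insert hi', exactlyOne_insert hi', exactlyOne_insert hj, exactlyOne_insert hj,
    Finset.prod_insert hj, Finset.prod_insert hj, exactlyOne_congr h,
    Finset.prod_congr rfl fun k hk => by rw [h k hk]]
  linear_combination (∏ k ∈ s, (1 - q k) - exactlyOne s q) * hsum

variable [Fintype ι]

lemma univ_eq_insert_insert {i j : ι} (hij : i ≠ j) :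
    (Finset.univ : Finset ι) = insert i (insert j ((Finset.univ.erase i).erase j)) := by
  rw [Finset.insert_erase (by simp [hij.symm]), Finset.insert_erase (Finset.mem_univ i)]

lemma exactlyOne_univ_transfer {i j : ι} (hij : i ≠ j) {q q' : ι → ℝ}
    (h : ∀ k, k ≠ i → k ≠ j → q' k = q k) (hsum : q' i + q' j = q i + q j) :
    exactlyOne Finset.univ q' - exactlyOne Finset.univ q =
      (exactlyOne ((Finset.univ.erase i).erase j) q -
        2 * ∏ k ∈ (Finset.univ.erase i).erase j, (1 - q k)) * (q' i * q' j - q i * q j) := by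
  have := exactlyOne_transfer (s := (Finset.univ.erase i).erase j) (by simp) (by simp) hij
    (q := q) (q' := q') (fun k hk => by simp at hk; exact h k hk.2 hk.1) hsum
  rwa [← univ_eq_insert_insert hij] at this

lemma sum_univ_transfer {i j : ι} (hij : i ≠ j) {q q' : ι → ℝ}
    (h : ∀ k, k ≠ i → k ≠ j → q' k = q k) (hsum : q' i + q' j = q i + q j) :
    ∑ k, q' k = ∑ k, q k := by
  rw [univ_eq_insert_insert hij, Finset.sum_insert (by simp [hij]), Finset.sum_insert (by simp),
    Finset.sum_insert (by simp [hij]), Finset.sum_insert (by simp),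
    Finset.sum_congr rfl fun k hk => h k (by simp at hk; exact hk.2) (by simp at hk; exact hk.1)]
  linarith

/-- Moving mass `δ` from `j` to `i` within the capped simplex. -/
lemma exists_transfer {c l δ : ℝ} {i j : ι} (hij : i ≠ j) {q : ι → ℝ}
    (hq : q ∈ cappedSimplex ι c l) (h0 : 0 ≤ δ) (hi : q i + δ ≤ c) (hj : δ ≤ q j) :
    ∃ q' ∈ cappedSimplex ι c l,
      exactlyOne Finset.univ q' - exactlyOne Finset.univ q =
      (exactlyOne ((Finset.univ.erase i).erase j) q -
        2 * ∏ k ∈ (Finset.univ.erase i).erase j, (1 - q k)) * (δ * (q j - q i - δ)) := by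
  set q' : ι → ℝ := Function.update (Function.update q i (q i + δ)) j (q j - δ) with hq'
  have ei : q' i = q i + δ := by simp [hq', Function.update_of_ne hij]
  have ej : q' j = q j - δ := by simp [hq']
  have ek : ∀ k, k ≠ i → k ≠ j → q' k = q k := fun k h1 h2 => by
    simp [hq', Function.update_of_ne h1, Function.update_of_ne h2]
  have hs : q' i + q' j = q i + q j := by rw [ei, ej]; ring
  refine ⟨q', ⟨fun k => ?_, by rw [sum_univ_transfer hij ek hs]; exact hq.2⟩, ?_⟩
  · by_cases h1 : k = i
    · rw [h1, ei]; exact ⟨by linarith [(hq.1 i).1], hi⟩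
    by_cases h2 : k = j
    · rw [h2, ej]; exact ⟨by linarith, by linarith [(hq.1 j).2]⟩
    rw [ek k h1 h2]; exact hq.1 k
  · rw [exactlyOne_univ_transfer hij ek hs, ei, ej]; ring

/-- At a maximizer, the largest coordinate attains the cap. -/
lemma IsMaxOn.exists_eq_cap [Nonempty ι] {c l : ℝ} (hc1 : c < 1) (hcl : c ≤ l) (hl : l ≤ 1)
    {q : ι → ℝ} (hq : q ∈ cappedSimplex ι c l)
    (hmax : IsMaxOn (exactlyOne Finset.univ) (cappedSimplex ι c l) q) :
    ∃ i, q i = c := by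
  obtain ⟨i, hi⟩ := Finite.exists_max q
  refine ⟨i, le_antisymm (hq.1 i).2 (le_of_not_gt fun hlt => ?_)⟩
  obtain ⟨j, hij, hj⟩ : ∃ j, i ≠ j ∧ 0 < q j := by
    by_contra! hcon
    have : ∑ k, q k = q i := Finset.sum_eq_single i
      (fun k _ hk => le_antisymm (hcon k hk.symm) (hq.1 k).1) (by simp)
    linarith [hq.2]
  set S := (Finset.univ.erase i).erase j with hS
  have hsum : q i + (q j + ∑ k ∈ S, q k) = l := by
    rw [← hq.2, univ_eq_insert_insert hij, Finset.sum_insert (by simp [hij]),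
      Finset.sum_insert (by simp)]
  have hA : 0 < ∏ k ∈ S, (1 - q k) := Finset.prod_pos fun k _ => by linarith [(hq.1 k).2]
  -- Since q k ≤ q i and both occur in a sum at most 1.
  have hhalf : ∀ k ∈ S, q k ≤ 1 / 2 := by
    intro k hk
    have := Finset.single_le_sum (f := q) (fun m _ => (hq.1 m).1) hk
    linarith [hi k]
  -- From q_k ≤ 1/2 one has q_k ≤ 2 q_k (1 - q_k), which restores the missing factor. As ∑_S q_k <
  -- 1, the slope B - 2A is negative and spreading the pair (i, j) helps.
  have hB : exactlyOne S q ≤ 2 * (∑ k ∈ S, q k) * ∏ k ∈ S, (1 - q k) := by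
    rw [exactlyOne, Finset.mul_sum, Finset.sum_mul]
    refine Finset.sum_le_sum fun k hk => ?_
    rw [← Finset.mul_prod_erase _ _ hk]
    have h1 : 0 ≤ ∏ m ∈ S.erase k, (1 - q m) :=
      Finset.prod_nonneg fun m _ => by linarith [(hq.1 m).2]
    have h2 := mul_nonneg (hq.1 k).1 h1
    nlinarith [hhalf k hk]
  -- Move as much as possible: until i reaches the cap or j is exhausted.
  obtain ⟨q', hq', he⟩ := exists_transfer hij hq (δ := min (c - q i) (q j))
    (le_min (by linarith) hj.le) (by linarith [min_le_left (c - q i) (q j)]) (min_le_right _ _)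
  have hδ : 0 < min (c - q i) (q j) := lt_min (by linarith) hj
  have h1 : exactlyOne S q - 2 * ∏ k ∈ S, (1 - q k) < 0 := by
    nlinarith [(hq.1 i).1]
  have h2 : min (c - q i) (q j) * (q j - q i - min (c - q i) (q j)) < 0 :=
    mul_neg_of_pos_of_neg hδ (by linarith [hi j])
  have h3 := mul_pos_of_neg_of_neg h1 h2
  have h4 := hmax hq'
  simp only [Set.mem_ofPred_eq] at h4
  linarith

/-- At a maximizer, the coordinates other than one at the cap `c > 2 / 3` are equal. -/
lemma IsMaxOn.eq_of_ne_cap {c l : ℝ} (hc : 2 / 3 < c) (hc1 : c < 1)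
    {q : ι → ℝ} (hq : q ∈ cappedSimplex ι c l)
    (hmax : IsMaxOn (exactlyOne Finset.univ) (cappedSimplex ι c l) q)
    {a : ι} (ha : q a = c) {i j : ι} (hia : i ≠ a) (hja : j ≠ a) : q i ≤ q j := by
  by_contra! hlt
  have hij : j ≠ i := fun h => by rw [h] at hlt; exact lt_irrefl _ hlt
  set S := (Finset.univ.erase j).erase i with hS
  have haS : a ∈ S := by simp [hS, hia.symm, hja.symm]
  have hP : 0 < ∏ k ∈ S.erase a, (1 - q k) :=
    Finset.prod_pos fun k _ => by linarith [(hq.1 k).2]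
  have hB : q a * ∏ k ∈ S.erase a, (1 - q k) ≤ exactlyOne S q :=
    Finset.single_le_sum (f := fun i => q i * ∏ k ∈ S.erase i, (1 - q k))
      (fun m _ => mul_nonneg (hq.1 m).1
        (Finset.prod_nonneg fun k _ => by linarith [(hq.1 k).2])) haS
  -- Half the difference makes the two coordinates equal.
  obtain ⟨q', hq', he⟩ := exists_transfer hij hq (δ := (q i - q j) / 2)
    (by linarith) (by linarith [(hq.1 i).2]) (by linarith [(hq.1 j).1])
  -- The term of a alone suffices: B - 2A ≥ (c - 2(1 - c)) ∏_{k ∈ S, k ≠ a}(1 - q_k), and 3c - 2 >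
  -- 0.
  have h1 : 0 < exactlyOne S q - 2 * ∏ k ∈ S, (1 - q k) := by
    rw [← Finset.mul_prod_erase _ _ haS]
    rw [ha] at hB ⊢
    nlinarith
  have h2 : 0 < (q i - q j) / 2 * (q i - q j - (q i - q j) / 2) := by
    have : 0 < q i - q j := by linarith
    nlinarith
  have h3 := mul_pos h1 h2
  have h4 := hmax hq'
  simp only [Set.mem_ofPred_eq] at h4
  linarith

/-- A maximizer exists by compactness, has one coordinate c, and its others share l - c equally; the
right-hand side is its value. -/
lemma exactlyOne_le_of_mem_cappedSimplex {c l : ℝ} (hc : 2 / 3 < c) (hc1 : c < 1)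
    (hcl : c ≤ l) (hl : l ≤ 1) (hn : 1 < Fintype.card ι)
    {q : ι → ℝ} (hq : q ∈ cappedSimplex ι c l) :
    exactlyOne Finset.univ q ≤
      c * (1 - (l - c) / (Fintype.card ι - 1 : ℕ)) ^ (Fintype.card ι - 1) +
      (1 - c) * (l - c) * (1 - (l - c) / (Fintype.card ι - 1 : ℕ)) ^ (Fintype.card ι - 2) := by
  obtain ⟨r, hr, hmax⟩ := (isCompact_cappedSimplex (ι := ι) c l).exists_isMaxOn ⟨q, hq⟩
    (exactlyOne_continuous Finset.univ).continuousOn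
  refine (hmax hq).trans ?_
  have : Nonempty ι := Fintype.card_pos_iff.1 (by omega)
  obtain ⟨a, ha⟩ := IsMaxOn.exists_eq_cap hc1 hcl hl hr hmax
  have hcard : (Finset.univ.erase a).card = Fintype.card ι - 1 := by
    rw [Finset.card_erase_of_mem (Finset.mem_univ a), Finset.card_univ]
  have hN : (0 : ℝ) < (Fintype.card ι - 1 : ℕ) := by exact_mod_cast (by omega)
  set y := (l - c) / (Fintype.card ι - 1 : ℕ) with hy
  have hr' : ∀ k ∈ Finset.univ.erase a, r k = y := by
    intro k hk
    have hka := Finset.ne_of_mem_erase hk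
    have h1 : ∑ m ∈ Finset.univ.erase a, r m = (Fintype.card ι - 1 : ℕ) * r k := by
      rw [Finset.sum_congr rfl (g := fun _ => r k) fun m hm =>
        le_antisymm (IsMaxOn.eq_of_ne_cap hc hc1 hr hmax ha (Finset.ne_of_mem_erase hm) hka)
          (IsMaxOn.eq_of_ne_cap hc hc1 hr hmax ha hka (Finset.ne_of_mem_erase hm))]
      rw [Finset.sum_const, hcard, nsmul_eq_mul]
    have h2 := Finset.add_sum_erase Finset.univ r (Finset.mem_univ a)
    rw [hr.2, ha, h1] at h2
    rw [hy, eq_div_iff hN.ne']; linarith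
  have huniv := Finset.insert_erase (Finset.mem_univ a)
  simp only
  rw [← huniv, exactlyOne_insert (by simp), exactlyOne_const _ hr',
    Finset.prod_congr rfl fun k hk => by rw [hr' k hk], Finset.prod_const, hcard, ha]
  have h3 : (Fintype.card ι - 1 : ℕ) * y = l - c := by rw [hy]; field_simp
  rw [h3, show Fintype.card ι - 1 - 1 = Fintype.card ι - 2 by omega]
  exact le_of_eq (by ring)

/-- Jensen for exp with weights w_i bounds the sum below by exp ∑_i w_i ∑_{j≠i} log(1 - w_j). Since
the weights sum to 1, that exponent is ∑_j (1 - w_j) log(1 - w_j), and Jensen for x log x at the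
mean 1 - 1/n finishes. -/
lemma le_exactlyOne_of_sum_eq_one {w : ι → ℝ} (h0 : ∀ i, 0 ≤ w i) (hs : ∑ i, w i = 1) :
    (1 - 1 / (Fintype.card ι : ℝ)) ^ (Fintype.card ι - 1) ≤ exactlyOne Finset.univ w := by
  have hne : (Finset.univ : Finset ι).Nonempty := by
    by_contra h
    rw [Finset.not_nonempty_iff_eq_empty] at h
    simp [h] at hs
  have : Nonempty ι := ⟨hne.choose⟩
  have hn : (1 : ℝ) ≤ Fintype.card ι := by exact_mod_cast Fintype.card_pos
  have hle : ∀ i, w i ≤ 1 := fun i => hs ▸ Finset.single_le_sum (fun k _ => h0 k) (Finset.mem_univ i)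
  have hinv : 1 / (Fintype.card ι : ℝ) ≤ 1 := by rw [div_le_one (by linarith)]; exact hn
  have hinv0 : 0 < 1 / (Fintype.card ι : ℝ) := by positivity
  -- A coordinate equal to 1 would put log 0 into the Jensen argument, so it is treated apart.
  by_cases h : ∃ i, w i = 1
  · obtain ⟨i, hi⟩ := h
    have hz : ∀ j, j ≠ i → w j = 0 := by
      intro j hj
      have h2 := Finset.add_sum_erase Finset.univ w (Finset.mem_univ i)
      have h3 := Finset.single_le_sum (f := w) (fun k _ => h0 k)
        (Finset.mem_erase.2 ⟨hj, Finset.mem_univ j⟩)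
      linarith [h0 j]
    have h1 : w i * ∏ k ∈ Finset.univ.erase i, (1 - w k) ≤ exactlyOne Finset.univ w :=
      Finset.single_le_sum (f := fun i => w i * ∏ k ∈ Finset.univ.erase i, (1 - w k))
        (fun m _ => mul_nonneg (h0 m)
          (Finset.prod_nonneg fun k _ => by linarith [hle k])) (Finset.mem_univ i)
    rw [Finset.prod_eq_one fun k hk => by rw [hz k (Finset.ne_of_mem_erase hk), sub_zero], hi,
      mul_one] at h1
    exact (pow_le_one₀ (by linarith) (by linarith)).trans h1
  · push Not at h
    have hlt : ∀ i, 0 < 1 - w i := fun i => by linarith [lt_of_le_of_ne (hle i) (h i)]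
    have hcard : 1 < Fintype.card ι := by
      by_contra hcon
      obtain ⟨i, hi⟩ := Fintype.card_eq_one_iff.1
        (le_antisymm (not_lt.1 hcon) Fintype.card_pos)
      apply h i
      rw [← hs]
      exact (Finset.sum_eq_single i (fun k _ hk => absurd (hi k) hk) (by simp)).symm
    have h1 : Real.exp (∑ i, w i • ∑ j ∈ Finset.univ.erase i, Real.log (1 - w j)) ≤
        ∑ i, w i • Real.exp (∑ j ∈ Finset.univ.erase i, Real.log (1 - w j)) :=
      convexOn_exp.map_sum_le (fun i _ => h0 i) hs fun _ _ => Set.mem_univ _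
    have h2 : ∑ i, w i • Real.exp (∑ j ∈ Finset.univ.erase i, Real.log (1 - w j)) =
        exactlyOne Finset.univ w :=
      Finset.sum_congr rfl fun i _ => by
        rw [Real.exp_sum, smul_eq_mul, Finset.prod_congr rfl fun j _ => Real.exp_log (hlt j)]
    have h3 : ∑ i, w i • ∑ j ∈ Finset.univ.erase i, Real.log (1 - w j) =
        ∑ i, (1 - w i) * Real.log (1 - w i) := by
      simp_rw [Finset.sum_erase_eq_sub (Finset.mem_univ _), smul_eq_mul, mul_sub, sub_mul]
      rw [Finset.sum_sub_distrib, Finset.sum_sub_distrib, ← Finset.sum_mul, hs]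
      simp_rw [one_mul]
    have h4 := Real.convexOn_mul_log.map_sum_le (t := Finset.univ)
      (w := fun _ : ι => 1 / (Fintype.card ι : ℝ)) (p := fun i => 1 - w i)
      (fun _ _ => hinv0.le) (by simp) (fun i _ => (hlt i).le)
    have h5 : ∑ i, (1 / (Fintype.card ι : ℝ)) • (1 - w i) = 1 - 1 / (Fintype.card ι : ℝ) := by
      rw [← Finset.smul_sum, Finset.sum_sub_distrib, hs]
      simp; field_simp
    have h7 : (1 : ℝ) < Fintype.card ι := by exact_mod_cast hcard
    rw [h5, ← Finset.smul_sum, smul_eq_mul] at h4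
    have h6 : ((Fintype.card ι - 1 : ℕ) : ℝ) * Real.log (1 - 1 / (Fintype.card ι : ℝ)) ≤
        ∑ i, (1 - w i) * Real.log (1 - w i) := by
      rw [Nat.cast_sub hcard.le, Nat.cast_one]
      have := mul_le_mul_of_nonneg_left h4 (by linarith : (0 : ℝ) ≤ Fintype.card ι)
      calc _ = (Fintype.card ι : ℝ) * ((1 - 1 / (Fintype.card ι : ℝ)) *
            Real.log (1 - 1 / (Fintype.card ι : ℝ))) := by field_simp
        _ ≤ _ := this
        _ = _ := by field_simp
    rw [← h2]
    refine le_trans ?_ h1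
    rw [h3]
    refine le_trans (le_of_eq ?_) (Real.exp_le_exp.2 h6)
    have : 0 < 1 - 1 / (Fintype.card ι : ℝ) := by
      rw [sub_pos, div_lt_one (by linarith)]; exact h7
    rw [Real.exp_nat_mul, Real.exp_log this]

/-- Normalize q to sum 1; since the sum is at most 1, this only shrinks the factors 1 - q_j. -/
lemma sum_mul_le_exactlyOne {q : ι → ℝ} (h0 : ∀ i, 0 ≤ q i) (hs : ∑ i, q i ≤ 1) :
    (∑ i, q i) * (1 - 1 / (Fintype.card ι : ℝ)) ^ (Fintype.card ι - 1) ≤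
      exactlyOne Finset.univ q := by
  have hle : ∀ i, q i ≤ ∑ i, q i :=
    fun i => Finset.single_le_sum (fun k _ => h0 k) (Finset.mem_univ i)
  rcases (Finset.sum_nonneg fun i _ => h0 i : 0 ≤ ∑ i, q i).eq_or_lt with h | h
  · rw [← h, zero_mul]
    exact exactlyOne_nonneg h0 fun i => (hle i).trans hs
  · have := le_exactlyOne_of_sum_eq_one (w := fun i => q i / ∑ i, q i)
      (fun i => div_nonneg (h0 i) h.le) (by rw [← Finset.sum_div, div_self h.ne'])
    refine (mul_le_mul_of_nonneg_left this h.le).trans ?_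
    rw [exactlyOne, Finset.mul_sum]
    refine Finset.sum_le_sum fun i _ => ?_
    rw [← mul_assoc, mul_div_cancel₀ _ h.ne']
    refine mul_le_mul_of_nonneg_left (Finset.prod_le_prod (fun j _ => ?_) fun j _ => ?_) (h0 i)
    · rw [sub_nonneg, div_le_one h]; exact hle j
    · have : q j ≤ q j / ∑ i, q i := by rw [le_div_iff₀ h]; nlinarith [h0 j]
      linarith

end ExactlyOne

end CSMA

/-! ### The extremal polynomial and bounds on the sum of grant probabilities. -/

namespace CSMA

/-- This is the maximum over the capped simplex with n = M + 2, written in v = 1 - (l - c)/(n - 1).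
The condition c ≥ 2/3 is exactly convexity for M = 1. -/
lemma convexOn_extremal {c : ℝ} (hc : 2 / 3 ≤ c) (hc1 : c ≤ 1) (M : ℕ) :
    ConvexOn ℝ (Set.Icc 0 1) fun v : ℝ =>
      (c - (1 - c) * (M + 1)) * v ^ (M + 1) + (1 - c) * (M + 1) * v ^ M := by
  refine convexOn_of_hasDerivWithinAt2_nonneg (convex_Icc 0 1) (by fun_prop)
    (f' := fun v => (c - (1 - c) * (M + 1)) * ((M + 1 : ℕ) * v ^ M) +
      (1 - c) * (M + 1) * (M * v ^ (M - 1)))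
    (f'' := fun v => (c - (1 - c) * (M + 1)) * ((M + 1 : ℕ) * (M * v ^ (M - 1))) +
      (1 - c) * (M + 1) * (M * ((M - 1 : ℕ) * v ^ (M - 1 - 1))))
    (fun v _ => ?_) (fun v _ => ?_) fun v hv => ?_
  · exact (((hasDerivAt_pow (M + 1) v).const_mul _).add
      ((hasDerivAt_pow M v).const_mul _)).hasDerivWithinAt
  · exact ((((hasDerivAt_pow M v).const_mul _).const_mul _).add
      (((hasDerivAt_pow (M - 1) v).const_mul _).const_mul _)).hasDerivWithinAt
  · rw [interior_Icc] at hv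
    obtain _ | _ | K := M
    · simp
    · simp; linarith
    · have hpow : v ^ (K + 1 + 1 - 1) = v ^ K * v := pow_succ v K
      have hpow' : v ^ (K + 1 + 1 - 1 - 1) = v ^ K := rfl
      have hK : ((K + 1 + 1 - 1 : ℕ) : ℝ) = K + 1 := by simp
      rw [hpow, hpow', hK]
      push_cast
      have h1 : 0 ≤ v ^ K := pow_nonneg hv.1.le K
      have h2 : 0 ≤ (K : ℝ) := K.cast_nonneg
      -- The relevant factor is affine in v, equal to (1 - c)(K + 1) at v = 0 and to 3c - 2 at v =
      -- 1.
      have h3 : 0 ≤ (c - (1 - c) * (K + 3)) * (K + 3) * v + (1 - c) * (K + 3) * (K + 1) := by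
        have h4 : 0 ≤ (K + 3) * ((c - (1 - c) * (K + 3)) * v + (1 - c) * (K + 1)) := by
          refine mul_nonneg (by linarith) ?_
          rcases le_total 0 (c - (1 - c) * (K + 3)) with h | h
          · have := mul_nonneg h hv.1.le
            have := mul_nonneg (sub_nonneg.2 hc1) (by linarith : (0 : ℝ) ≤ K + 1)
            linarith
          · have := mul_nonneg_of_nonpos_of_nonpos h (by linarith [hv.2] : v - 1 ≤ 0)
            linarith
        linarith
      have := mul_nonneg (mul_nonneg (by linarith : (0 : ℝ) ≤ K + 2) h1) h3
      linarith

/-- Identifies Ψ, up to the factor c, with the extremal polynomial at l = 1, that is at s = (b+1)/b.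
-/
lemma mul_Psi {b : ℝ} (hb : 0 < b) (M : ℕ) :
    b / (b + 1) * Psi b (M + 2) =
      (b / (b + 1) - (1 - b / (b + 1)) * (M + 1)) *
        (1 - (1 - b / (b + 1)) / (M + 1)) ^ (M + 1) +
      (1 - b / (b + 1)) * (M + 1) * (1 - (1 - b / (b + 1)) / (M + 1)) ^ M := by
  have hM : (0 : ℝ) < M + 1 := by positivity
  have hv : (b * ((M + 2 : ℕ) : ℝ) + ((M + 2 : ℕ) : ℝ) - b - 2) /
      ((1 + b) * (((M + 2 : ℕ) : ℝ) - 1)) = 1 - (1 - b / (b + 1)) / (M + 1) := by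
    push_cast
    have : (M : ℝ) + 2 - 1 = M + 1 := by ring
    rw [this]; field_simp; ring
  have hf : b / (b + 1) * (((((M + 2 : ℕ) : ℝ) - 1) * (1 + b) ^ 2 - ((M + 2 : ℕ) : ℝ) * b) /
      (b * (1 + b) * (((M + 2 : ℕ) : ℝ) - 1))) =
      (b / (b + 1) - (1 - b / (b + 1)) * (M + 1)) * (1 - (1 - b / (b + 1)) / (M + 1)) +
      (1 - b / (b + 1)) * (M + 1) := by
    push_cast
    have : (M : ℝ) + 2 - 1 = M + 1 := by ring
    rw [this]; field_simp; ring
  rw [Psi, hv, ← mul_assoc, hf, show M + 2 - 2 = M by omega]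
  ring

lemma Psi_nonneg_and_le_one {b : ℝ} (hb : 1 < b) {n : ℕ} (hn : 1 < n) :
    0 ≤ Psi b n ∧ Psi b n ≤ 1 := by
  obtain ⟨M, rfl⟩ := Nat.exists_eq_add_of_le' hn
  have hM : (0 : ℝ) ≤ M := M.cast_nonneg
  have h := mul_Psi (by linarith : 0 < b) M
  have hc0 : 0 < b / (b + 1) := by positivity
  have hc : 1 / 2 < b / (b + 1) := by rw [lt_div_iff₀ (by linarith)]; linarith
  have hc1 : b / (b + 1) < 1 := by rw [div_lt_one (by linarith)]; linarith
  change 0 ≤ Psi b (M + 2) ∧ Psi b (M + 2) ≤ 1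
  set c := b / (b + 1)
  set y := (1 - c) / (M + 1) with hy
  have hyM : y * (M + 1) = 1 - c := by rw [hy]; field_simp
  have hy0 : 0 ≤ y := div_nonneg (by linarith) (by linarith)
  have hy1 : y ≤ 1 := by nlinarith
  have h' : c * Psi b (M + 2) = (1 - y) ^ M * (c + y * ((1 - c) * (M + 1) - c)) := by
    rw [h, pow_succ]
    ring
  have hv : 0 ≤ (1 - y) ^ M := pow_nonneg (by linarith) M
  constructor
  · refine nonneg_of_mul_nonneg_right (a := c) ?_ hc0
    rw [h']
    refine mul_nonneg hv ?_
    have h1 : 0 ≤ (1 - c) * (M + 1) := mul_nonneg (by linarith) (by linarith)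
    nlinarith [mul_nonneg hy0 h1]
  · refine le_of_mul_le_mul_left (a := c) ?_ hc0
    -- Uses 1 - c ≤ c. Next, Bernoulli gives 1 + M y ≤ (1 + y)^M, and (1 - y)^M (1 + y)^M = (1 -
    -- y²)^M ≤ 1.
    have h1 : c + y * ((1 - c) * (M + 1) - c) ≤ c * (1 + M * y) := by
      have : y * ((1 - c) * (M + 1)) ≤ y * (c * (M + 1)) := by gcongr; linarith
      linarith
    have h2 : (1 - y) ^ M * (1 + M * y) ≤ 1 := by
      have h3 := mul_le_mul_of_nonneg_left (one_add_mul_le_pow (by linarith : -2 ≤ y) M) hv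
      rw [← mul_pow] at h3
      exact h3.trans (pow_le_one₀ (mul_nonneg (by linarith) (by linarith)) (by nlinarith))
    calc c * Psi b (M + 2) ≤ (1 - y) ^ M * (c * (1 + M * y)) := by rw [h']; gcongr
      _ = c * ((1 - y) ^ M * (1 + M * y)) := by ring
      _ ≤ c * 1 := by gcongr

section Bounds

variable {n : ℕ} {b : ℝ} {p : Fin n → ℝ}

/-- The sum over the nodes of the probability that the node is granted the channel in the absence
of noise, as a function of the request probabilities. -/
noncomputable def grantSum (b : ℝ) (p : Fin n → ℝ) : ℝ :=
  ∑ i, p i * ∏ j ∈ Finset.univ.erase i, (1 - b / (b + 1) * p j)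

lemma exactlyOne_eq_mul_grantSum :
    exactlyOne Finset.univ (fun i => b / (b + 1) * p i) = b / (b + 1) * grantSum b p := by
  simp_rw [exactlyOne, grantSum, Finset.mul_sum, mul_assoc]

lemma grantSum_le_sum (hb : 1 < b) (h0 : ∀ i, 0 ≤ p i) (h1 : ∀ i, p i ≤ 1) :
    grantSum b p ≤ ∑ i, p i := by
  have hc0 : 0 < b / (b + 1) := by positivity
  have hc1 : b / (b + 1) < 1 := by rw [div_lt_one (by linarith)]; linarith
  have h := exactlyOne_le_sum (s := Finset.univ) (q := fun i => b / (b + 1) * p i)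
    (fun i => mul_nonneg hc0.le (h0 i)) fun i => by nlinarith [h0 i, h1 i]
  rw [exactlyOne_eq_mul_grantSum, ← Finset.mul_sum] at h
  exact le_of_mul_le_mul_left h hc0

lemma mul_Gam_le_grantSum (hb : 1 < b) (h0 : ∀ i, 0 ≤ p i) (hs : ∑ i, p i ≤ (b + 1) / b) :
    b / (b + 1) * (∑ i, p i) * Gam b n ≤ grantSum b p := by
  have hc0 : 0 < b / (b + 1) := by positivity
  have h := sum_mul_le_exactlyOne (q := fun i => b / (b + 1) * p i)
    (fun i => mul_nonneg hc0.le (h0 i)) (by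
      rw [← Finset.mul_sum]
      calc _ ≤ b / (b + 1) * ((b + 1) / b) := by gcongr
        _ = 1 := by field_simp)
  rw [exactlyOne_eq_mul_grantSum, ← Finset.mul_sum, Fintype.card_fin, mul_assoc] at h
  refine le_trans (le_of_eq ?_) (le_of_mul_le_mul_left h hc0)
  rw [Gam]; field_simp

/-- The right-hand side is the chord of the convex maximum: its parameter t = b(s - 1) runs from 0
at s = 1, value 1, to 1 at s = (b+1)/b, value Ψ. -/
lemma grantSum_le_of_one_le_sum (hb : 2 < b) (hn : 1 < n) (h0 : ∀ i, 0 ≤ p i)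
    (h1 : ∀ i, p i ≤ 1) (hs1 : 1 ≤ ∑ i, p i) (hs : ∑ i, p i ≤ (b + 1) / b) :
    grantSum b p ≤ 1 - (1 - Psi b n) * (b * (∑ i, p i - 1)) := by
  obtain ⟨M, rfl⟩ := Nat.exists_eq_add_of_le' hn
  have hc0 : 0 < b / (b + 1) := by positivity
  have hc : 2 / 3 < b / (b + 1) := by rw [lt_div_iff₀ (by linarith)]; linarith
  have hc1 : b / (b + 1) < 1 := by rw [div_lt_one (by linarith)]; linarith
  have hcs : b / (b + 1) * ∑ i, p i ≤ 1 := by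
    calc _ ≤ b / (b + 1) * ((b + 1) / b) := by gcongr
        _ = 1 := by field_simp
  have hM : (0 : ℝ) ≤ M := M.cast_nonneg
  have h := exactlyOne_le_of_mem_cappedSimplex hc hc1 (l := b / (b + 1) * ∑ i, p i)
    (by nlinarith) hcs (by simp) (q := fun i => b / (b + 1) * p i)
    ⟨fun i => ⟨mul_nonneg hc0.le (h0 i), by nlinarith [h1 i]⟩, by rw [Finset.mul_sum]⟩
  rw [exactlyOne_eq_mul_grantSum, Fintype.card_fin] at h
  have hP := mul_Psi (by linarith : 0 < b) M
  have ht0 : 0 ≤ b * (∑ i, p i - 1) := mul_nonneg (by linarith) (by linarith)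
  have ht1 : b * (∑ i, p i - 1) ≤ 1 := by
    rw [le_div_iff₀ (by linarith)] at hs; linarith
  have htc : b / (b + 1) * ∑ i, p i - b / (b + 1) =
      (1 - b / (b + 1)) * (b * (∑ i, p i - 1)) := by field_simp; ring
  change b / (b + 1) * grantSum b p ≤
    b / (b + 1) * (1 - (b / (b + 1) * ∑ i, p i - b / (b + 1)) / (M + 1 : ℕ)) ^ (M + 1) +
    (1 - b / (b + 1)) * (b / (b + 1) * ∑ i, p i - b / (b + 1)) *
      (1 - (b / (b + 1) * ∑ i, p i - b / (b + 1)) / (M + 1 : ℕ)) ^ M at h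
  rw [htc] at h
  refine le_of_mul_le_mul_left (h.trans ?_) hc0
  set t := b * (∑ i, p i - 1)
  set c := b / (b + 1)
  set v := 1 - (1 - c) / ((M : ℝ) + 1) with hv
  have hv1 : v ≤ 1 := by
    have : 0 ≤ (1 - c) / ((M : ℝ) + 1) := div_nonneg (by linarith) (by linarith)
    linarith
  have hv0 : 0 ≤ v := by
    rw [hv, sub_nonneg, div_le_one (by linarith)]; linarith
  have hconv := (convexOn_extremal hc.le hc1.le M).2 (by simp : (1 : ℝ) ∈ Set.Icc 0 1)
    ⟨hv0, hv1⟩ (by linarith : 0 ≤ 1 - t) ht0 (by ring)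
  simp only [smul_eq_mul] at hconv
  rw [← hP] at hconv
  -- The point v is affine in s, so convexity in v yields the chord in s.
  have hw : (1 - t) * 1 + t * v = 1 - (1 - c) * t / (M + 1 : ℕ) := by
    rw [hv]; push_cast; ring
  have hw' : (1 - c) * t = (M + 1) * (1 - ((1 - t) * 1 + t * v)) := by
    rw [hv]; field_simp; ring
  rw [← hw, hw']
  calc _ = _ := ?_
    _ ≤ _ := hconv
    _ = _ := by simp; ring
  rw [pow_succ]
  ring

end Bounds

/-! ### Scalar inequalities for (βs + x)/(1 + x). -/

lemma add_div_one_add_le {a x y : ℝ} (ha : a ≤ 1) (hx : 0 ≤ x) (hxy : x ≤ y) :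
    (a + x) / (1 + x) ≤ (a + y) / (1 + y) := by
  rw [div_le_div_iff₀ (by linarith) (by linarith)]
  nlinarith

lemma add_div_one_add_le' {a x y : ℝ} (ha : 1 ≤ a) (hy : 0 ≤ y) (hxy : y ≤ x) :
    (a + x) / (1 + x) ≤ (a + y) / (1 + y) := by
  rw [div_le_div_iff₀ (by linarith) (by linarith)]
  nlinarith

section Power

variable {β b m s x P : ℝ}

/-- The power bound at total request rate at most one. -/
lemma power_le_of_sum_le_one (hβ : 0 ≤ β) (hβ1 : β ≤ 1) (hm : 0 ≤ m) (hs1 : s ≤ 1)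
    (hx : 0 ≤ x) (hxs : x ≤ m * s) (hs : 0 ≤ s) :
    (β * s + x) / (1 + x) ≤ (m + β) / (m + 1) := by
  refine (add_div_one_add_le (by nlinarith) hx hxs).trans ?_
  have := mul_nonneg hm hs
  rw [div_le_div_iff₀ (by linarith) (by linarith)]
  nlinarith [mul_nonneg (add_nonneg hm hβ) (sub_nonneg.2 hs1)]

/-- The power bound at total request rate between `1` and `(b + 1) / b`, from the values at the
two endpoints. -/
lemma power_le_of_one_le_sum {V : ℝ} (hb : 0 < b) (hs1 : 1 ≤ s)
    (hs : s ≤ (b + 1) / b) (hm : 0 ≤ m) (hβ : 0 ≤ β) (hβc : β * ((b + 1) / b) ≤ 1) (hx : 0 ≤ x)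
    (hxs : x ≤ m * (1 - (1 - P) * (b * (s - 1)))) (hP : 0 ≤ P)
    (hV1 : (m + β) / (m + 1) ≤ V)
    (hV2 : (m * P + β * ((b + 1) / b)) / (m * P + 1) ≤ V) :
    (β * s + x) / (1 + x) ≤ V := by
  have h1 : β * s ≤ 1 := le_trans (by gcongr) hβc
  refine (add_div_one_add_le h1 hx hxs).trans ?_
  have hmP := mul_nonneg hm hP
  rw [div_le_iff₀ (by linarith)] at hV1 hV2 ⊢
  have ht0 : 0 ≤ b * (s - 1) := mul_nonneg hb.le (by linarith)
  have ht1 : b * (s - 1) ≤ 1 := by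
    rw [le_div_iff₀ hb] at hs; linarith
  -- After clearing denominators the inequality is affine in t = b(s - 1), hence the combination of
  -- the endpoint inequalities with weights 1 - t and t.
  have h2 := mul_le_mul_of_nonneg_left hV1 (sub_nonneg.2 ht1)
  have h3 := mul_le_mul_of_nonneg_left hV2 ht0
  have h4 : b * (s - 1) * (β * ((b + 1) / b)) = β * (s - 1) * (b + 1) := by field_simp
  linarith

lemma threshold_comparison (hb : 0 < b) (hm : 0 ≤ m) (hP : 0 ≤ P) :
    (m * P + β * ((b + 1) / b)) / (m * P + 1) ≤ (m + β) / (m + 1) ↔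
      β * (1 + m + m * b * (1 - P)) ≤ m * b * (1 - P) := by
  have hmP := mul_nonneg hm hP
  rw [div_le_div_iff₀ (by linarith) (by linarith), ← mul_le_mul_iff_right₀ hb]
  have : b * ((m * P + β * ((b + 1) / b)) * (m + 1)) =
      (b * (m * P) + β * (b + 1)) * (m + 1) := by field_simp
  rw [this]
  constructor <;> intro h <;> linarith

lemma threshold_comparison' (hb : 0 < b) (hm : 0 ≤ m) (hP : 0 ≤ P) :
    (m + β) / (m + 1) ≤ (m * P + β * ((b + 1) / b)) / (m * P + 1) ↔
      m * b * (1 - P) ≤ β * (1 + m + m * b * (1 - P)) := by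
  have hmP := mul_nonneg hm hP
  rw [div_le_div_iff₀ (by linarith) (by linarith), ← mul_le_mul_iff_right₀ hb]
  have : b * ((m * P + β * ((b + 1) / b)) * (m + 1)) =
      (b * (m * P) + β * (b + 1)) * (m + 1) := by field_simp
  rw [this]
  constructor <;> intro h <;> linarith

/-- If βs ≤ 1 the quotient is at most 1, hence at most the bound. Otherwise it decreases in x;
inserting the lower bound for x leaves σ(B + mG)/(1 + σmG) with σ = bs/(b+1) ≤ 1 and B = β(b+1)/b,
which is largest at σ = 1. -/
lemma power_le_of_large_beta (hb : 0 < b) {G : ℝ} (hG : 0 ≤ G) (hm : 0 ≤ m) (hs0 : 0 ≤ s)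
    (hs : s ≤ (b + 1) / b) (hβ : 1 ≤ β * ((b + 1) / b)) (hx : 0 ≤ x)
    (hxs : m * (b / (b + 1) * s * G) ≤ x) :
    (β * s + x) / (1 + x) ≤ (m * G + β * ((b + 1) / b)) / (m * G + 1) := by
  have hmG := mul_nonneg hm hG
  rcases le_total (β * s) 1 with h | h
  · calc (β * s + x) / (1 + x) ≤ 1 := by rw [div_le_one (by linarith)]; linarith
      _ ≤ _ := by rw [one_le_div (by linarith)]; linarith
  · have hσ0 : 0 ≤ b / (b + 1) * s := by positivity
    have hσ1 : b / (b + 1) * s ≤ 1 := by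
      calc _ ≤ b / (b + 1) * ((b + 1) / b) := by gcongr
        _ = 1 := by field_simp
    have hy : 0 ≤ m * (b / (b + 1) * s * G) := by positivity
    refine (add_div_one_add_le' h hy hxs).trans ?_
    rw [div_le_div_iff₀ (by linarith) (by linarith)]
    have hσ : β * s = b / (b + 1) * s * (β * ((b + 1) / b)) := by field_simp
    rw [hσ]
    set σ := b / (b + 1) * s
    set B := β * ((b + 1) / b)
    nlinarith [mul_nonneg (sub_nonneg.2 hσ1) (by linarith : 0 ≤ m * G + B)]

end Power

end CSMA

/-! ### Weights of the individual nodes and the final case analysis. -/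

namespace CSMA
namespace Network

variable {n : ℕ} (N : Network n)

lemma grantWeight_bounds {T : Fin n → ℝ} (hT : ∀ i, 0 < T i) (i : Fin n) :
    N.mLower T ≤ T i / N.T₀ * Real.exp (-(N.b * (N.N₀ / N.PT))) ∧
      T i / N.T₀ * Real.exp (-(N.b * (N.N₀ / N.PT))) ≤ N.mUpper T ∧ 0 ≤ N.mLower T := by
  have hT₀ := N.T₀_pos
  have : Nonempty (Fin n) := ⟨i⟩
  refine ⟨?_, ?_, ?_⟩
  · exact mul_le_mul_of_nonneg_right (ciInf_le (Set.finite_range _).bddBelow i)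
      (Real.exp_pos _).le
  · exact mul_le_mul_of_nonneg_right (le_ciSup (f := fun i => T i / N.T₀)
      (Set.finite_range _).bddAbove i) (Real.exp_pos _).le
  · exact mul_nonneg (le_ciInf fun j => (div_pos (hT j) hT₀).le) (Real.exp_pos _).le

/-- The total power in terms of the total request rate and a weighted sum of grant probabilities
that lies between `mLower` and `mUpper` times their unweighted sum. -/
lemma exists_sum_power_eq {T : Fin n → ℝ} (hT : ∀ i, 0 < T i) (p : Request n) :
    ∃ x, 0 ≤ x ∧ N.mLower T * grantSum N.b (fun i => (p i : ℝ)) ≤ x ∧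
      x ≤ N.mUpper T * grantSum N.b (fun i => (p i : ℝ)) ∧
      ∑ i, N.power T i p = (N.β * ∑ i, (p i : ℝ) + x) / (1 + x) := by
  have hb := N.one_lt_b
  have hc0 : 0 < N.b / (N.b + 1) := by positivity
  have hc1 : N.b / (N.b + 1) < 1 := by rw [div_lt_one (by linarith)]; linarith
  have hg : ∀ i, 0 ≤ (p i : ℝ) * ∏ j ∈ Finset.univ.erase i, (1 - N.b / (N.b + 1) * p j) :=
    fun i => mul_nonneg (p i).2.1 <| Finset.prod_nonneg fun j _ => by
      nlinarith [(p j).2.1, (p j).2.2]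
  refine ⟨_, ?_, ?_, ?_, N.sum_power_eq T p⟩
  · exact Finset.sum_nonneg fun i _ => mul_nonneg
      ((N.grantWeight_bounds hT i).2.2.trans (N.grantWeight_bounds hT i).1) (hg i)
  · rw [grantSum, Finset.mul_sum]
    exact Finset.sum_le_sum fun i _ =>
      mul_le_mul_of_nonneg_right (N.grantWeight_bounds hT i).1 (hg i)
  · rw [grantSum, Finset.mul_sum]
    exact Finset.sum_le_sum fun i _ =>
      mul_le_mul_of_nonneg_right (N.grantWeight_bounds hT i).2.1 (hg i)

end Network

lemma Gam_nonneg {b : ℝ} (hb : 0 < b) {n : ℕ} (hn : 1 ≤ n) : 0 ≤ Gam b n := by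
  have : (1 : ℝ) / n ≤ 1 := by
    rw [div_le_one (by positivity)]; exact_mod_cast hn
  exact mul_nonneg (by positivity) (pow_nonneg (by linarith) _)

end CSMA

theorem mainTheorem4 (n : ℕ) (hn : 1 ≤ n) (N : CSMA.Network n) (hb : 2 < N.b)
    (T : Fin n → ℝ) (hT : ∀ i, 0 < T i)
    (ρ : Fin n → ℝ) (hρ : ρ ∈ N.feasibleRegion T)
    (p : CSMA.Request n) (hp : N.IsBetterNash T ρ p) :
    (n = 1 →
      ∑ i, N.power T i p ≤ (N.mUpper T + N.β) / (N.mUpper T + 1)) ∧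
    (1 < n →
      (N.β ≤ CSMA.threshold N.b n (N.mUpper T) →
        ∑ i, N.power T i p ≤ (N.mUpper T + N.β) / (N.mUpper T + 1)) ∧
      (CSMA.threshold N.b n (N.mUpper T) ≤ N.β → N.β ≤ N.b / (N.b + 1) →
        ∑ i, N.power T i p ≤
          (N.mUpper T * CSMA.Psi N.b n + N.β * ((N.b + 1) / N.b)) /
            (N.mUpper T * CSMA.Psi N.b n + 1)) ∧
      (N.b / (N.b + 1) ≤ N.β →
        ∑ i, N.power T i p ≤
          (N.mLower T * CSMA.Gam N.b n + N.β * ((N.b + 1) / N.b)) /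
            (N.mLower T * CSMA.Gam N.b n + 1))) ∧
    ∑ i, N.power T i p ≤ max 1 (N.β * ((N.b + 1) / N.b)) := by
  have hb0 : 0 < N.b := by linarith
  have h0 : ∀ i, 0 ≤ (p i : ℝ) := fun i => (p i).2.1
  have h1 : ∀ i, (p i : ℝ) ≤ 1 := fun i => (p i).2.2
  have hs := hp.2
  have hs0 : 0 ≤ ∑ i, (p i : ℝ) := Finset.sum_nonneg fun i _ => h0 i
  have hβ0 : 0 < N.β := div_pos N.TRTS_pos N.T₀_pos
  have hβ1 : N.β < 1 := (div_lt_one N.T₀_pos).2 N.TRTS_lt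
  obtain ⟨x, hx0, hxL, hxU, hpow⟩ := N.exists_sum_power_eq hT p
  have hmL : 0 ≤ N.mLower T := (N.grantWeight_bounds hT ⟨0, hn⟩).2.2
  have hmU : 0 ≤ N.mUpper T :=
    hmL.trans ((N.grantWeight_bounds hT ⟨0, hn⟩).1.trans (N.grantWeight_bounds hT ⟨0, hn⟩).2.1)
  have hxs : x ≤ N.mUpper T * ∑ i, (p i : ℝ) :=
    hxU.trans (mul_le_mul_of_nonneg_left (CSMA.grantSum_le_sum N.one_lt_b h0 h1) hmU)
  have hsmall := fun h => CSMA.power_le_of_sum_le_one hβ0.le hβ1.le hmU h hx0 hxs hs0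
  have hiff : N.β ≤ N.b / (N.b + 1) ↔ N.β * ((N.b + 1) / N.b) ≤ 1 := by
    rw [le_div_iff₀ (by linarith), ← mul_div_assoc, div_le_one hb0]
  rw [hpow]
  refine ⟨?_, fun hn1 => ?_, ?_⟩
  · rintro rfl
    exact hsmall (by simpa using h1 0)
  · obtain ⟨hP0, hP1⟩ := CSMA.Psi_nonneg_and_le_one N.one_lt_b hn1
    have hden : 0 < 1 + N.mUpper T + N.mUpper T * N.b * (1 - CSMA.Psi N.b n) := by
      have := mul_nonneg (mul_nonneg hmU hb0.le) (sub_nonneg.2 hP1)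
      linarith
    have hmid : ∀ {V : ℝ}, N.β ≤ N.b / (N.b + 1) →
        (N.mUpper T + N.β) / (N.mUpper T + 1) ≤ V →
        (N.mUpper T * CSMA.Psi N.b n + N.β * ((N.b + 1) / N.b)) /
          (N.mUpper T * CSMA.Psi N.b n + 1) ≤ V →
        (N.β * ∑ i, (p i : ℝ) + x) / (1 + x) ≤ V := by
      intro V hβc hV1 hV2
      rcases le_total (∑ i, (p i : ℝ)) 1 with h | h
      · exact (hsmall h).trans hV1
      · exact CSMA.power_le_of_one_le_sum hb0 h hs hmU hβ0.le (hiff.1 hβc) hx0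
          (hxU.trans (mul_le_mul_of_nonneg_left
            (CSMA.grantSum_le_of_one_le_sum hb hn1 h0 h1 h hs) hmU)) hP0 hV1 hV2
    refine ⟨fun hβ => ?_, fun hβ hβc => ?_, fun hβ => ?_⟩
    · rw [CSMA.threshold, le_div_iff₀ hden] at hβ
      refine hmid ?_ le_rfl ((CSMA.threshold_comparison hb0 hmU hP0).2 hβ)
      -- β ≤ θ already forces β ≤ b/(b+1): it gives β(1 + m) ≤ (1 - β) m b (1 - Ψ) ≤ (1 - β) b (1 +
      -- m).
      rw [le_div_iff₀ (by linarith)]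
      have hmb : 0 ≤ (1 - N.β) * (N.mUpper T * N.b * CSMA.Psi N.b n) :=
        mul_nonneg (by linarith) (mul_nonneg (mul_nonneg hmU hb0.le) hP0)
      have hb' : 0 ≤ (1 - N.β) * N.b := mul_nonneg (by linarith) hb0.le
      refine le_of_mul_le_mul_right ?_ (by linarith : 0 < 1 + N.mUpper T)
      linarith
    · rw [CSMA.threshold, div_le_iff₀ hden] at hβ
      exact hmid hβc ((CSMA.threshold_comparison' hb0 hmU hP0).2 hβ) le_rfl
    · refine CSMA.power_le_of_large_beta hb0 (CSMA.Gam_nonneg hb0 hn) hmL hs0 hs ?_ hx0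
        ((mul_le_mul_of_nonneg_left (CSMA.mul_Gam_le_grantSum N.one_lt_b h0 hs) hmL).trans hxL)
      rw [div_le_iff₀ (by linarith)] at hβ
      rwa [← mul_div_assoc, one_le_div hb0]
  -- A weighted mean of βs and 1 is at most their maximum, and βs ≤ β(b+1)/b.
  · rw [div_le_iff₀ (by linarith)]
    have hM1 := le_max_left 1 (N.β * ((N.b + 1) / N.b))
    have hM2 := le_max_right 1 (N.β * ((N.b + 1) / N.b))
    have h2 : N.β * ∑ i, (p i : ℝ) ≤ N.β * ((N.b + 1) / N.b) :=
      mul_le_mul_of_nonneg_left hs hβ0.le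
    nlinarith [mul_nonneg (sub_nonneg.2 hM1) hx0]
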